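/- Let $k \ge 4$ and let $q_1,\dots,q_k$ be nonnegative integers with $q_1 \ne 0 \ne q_k$. Let $T(q_1,\dots,q_k)$ be the caterpillar obtained from the path $v_1 v_2 \cdots v_k$ by attaching $q_i$ pendant vertices to $v_i$ for each $i \in \{1,\dots,k\}$, and let $\mu(q_1,\dots,q_k)$ denote its algebraic connectivity, that is, the second smallest eigenvalue (counted with multiplicity) of its Laplacian matrix. For nonnegative integers $a,b$ put $$ C(a,b)=\begin{pmatrix} \max\{0,a-1\} & \sqrt{a} & 0\\ \sqrt{a} & 0 & \sqrt{b}\\ 0 & \sqrt{b} & \max\{0,b-1\}\end{pmatrix}, $$ and let $\lambda_3(C(a,b))$ denote the least eigenvalue of this real symmetric matrix. Then $$ \mu(q_1,\dots,q_k)\ \le\ \min_{j\in\{1,\dots,k-1\}} \lambda_3\bigl(C(q_j,q_{j+1})\bigr)+2 . $$ -/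

import Mathlib

namespace Caterpillar

/-- The vertices of the caterpillar `T(q₁, …, q_k)`: the `k` vertices of the path (`Sum.inl`), and,
for each path vertex `i`, its `q i` pendant vertices (`Sum.inr`). -/
abbrev Vertex {k : ℕ} (q : Fin k → ℕ) : Type := Fin k ⊕ (Σ i : Fin k, Fin (q i))

/-- Adjacency in `T(q₁, …, q_k)`: consecutive path vertices are adjacent, and a pendant vertex is
adjacent to the path vertex it is attached to. -/
def adj {k : ℕ} (q : Fin k → ℕ) : Vertex q → Vertex q → Prop
  | .inl i, .inl j => (SimpleGraph.pathGraph k).Adj i j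
  | .inl i, .inr p => p.1 = i
  | .inr p, .inl i => p.1 = i
  | .inr _, .inr _ => False

/-- The caterpillar `T(q₁, …, q_k)`: the path on `k` vertices, where the central vertex of a star
with `q i` pendant vertices is identified with the `i`-th vertex of the path. -/
def graph {k : ℕ} (q : Fin k → ℕ) : SimpleGraph (Vertex q) where
  Adj := adj q
  symm := ⟨by
    rintro (i | p) (j | p') h
    · exact SimpleGraph.Adj.symm h
    · exact h
    · exact h
    · exact h⟩
  loopless := ⟨by
    rintro (i | p) h
    · exact (SimpleGraph.pathGraph k).loopless.irrefl i h
    · exact h⟩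

theorem two_le_card_vertex {k : ℕ} (q : Fin k → ℕ) (hk : 2 ≤ k) :
    2 ≤ Fintype.card (Vertex q) := by
  rw [Fintype.card_sum, Fintype.card_fin]
  omega

open Classical in
/-- The algebraic connectivity of a graph of order `n ≥ 2`: the second smallest eigenvalue of its
Laplacian matrix, counted with multiplicity. The family `eigenvalues₀` lists the eigenvalues with
multiplicity in non-increasing order, starting from index `0`. -/
noncomputable def algebraicConnectivity {V : Type*} [Fintype V] (G : SimpleGraph V)
    (hV : 2 ≤ Fintype.card V) : ℝ :=
  (G.isHermitian_lapMatrix ℝ).eigenvalues₀ ⟨Fintype.card V - 2, by omega⟩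

/-- `μ(q₁, …, q_k)`: the algebraic connectivity of the caterpillar `T(q₁, …, q_k)`. -/
noncomputable def mu {k : ℕ} (q : Fin k → ℕ) (hk : 2 ≤ k) : ℝ :=
  algebraicConnectivity (graph q) (two_le_card_vertex q hk)

/-- The `3 × 3` matrix `C(a, b)`. -/
noncomputable def C (a b : ℕ) : Matrix (Fin 3) (Fin 3) ℝ :=
  !![max 0 ((a : ℝ) - 1), √(a : ℝ), 0;
     √(a : ℝ), 0, √(b : ℝ);
     0, √(b : ℝ), max 0 ((b : ℝ) - 1)]

theorem isHermitian_C (a b : ℕ) : (C a b).IsHermitian := by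
  ext i j
  fin_cases i <;> fin_cases j <;> simp [C, Matrix.conjTranspose_apply]

/-- `λ₃(C(a, b))`: the third largest, that is, the least eigenvalue of `C(a, b)`. -/
noncomputable def lambda3 (a b : ℕ) : ℝ :=
  (isHermitian_C a b).eigenvalues₀ ⟨2, by simp⟩

end Caterpillar

namespace Caterpillar

open Matrix

/-! Every Laplacian eigenvalue is 0 or at least `μ`, so `L ^ 2 - μ L` is positive semidefinite: `μ *
gᵀLg ≤ |Lg|²`. This needs no orthogonality of `g` to constants and involves only the differences of
`g` along edges. Let these differences be supported on the edge `mn` (value `t`) and on the pendant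
edges at `m` and `n` (values `s` and `u` up to sign). In the coordinates `√a * s, t, √b * u` with `a
= q m`, `b = q n`, the inequality reads `μ ≤ C(a, b) + 2` as quadratic forms when `a, b ≥ 1`. A unit
eigenvector for the least eigenvalue of `C(a, b)` then gives the bound. -/

/-- The quadratic form of `L ^ 2 - μ L` is nonnegative, where `L` is the Laplacian matrix of a graph
and `μ` its algebraic connectivity. -/
theorem algebraicConnectivity_mul_dotProduct_le {V : Type*} [Fintype V] [hd : DecidableEq V]
    (G : SimpleGraph V) [hr : DecidableRel G.Adj] (hV : 2 ≤ Fintype.card V) (g : V → ℝ) :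
    algebraicConnectivity G hV * (g ⬝ᵥ (G.lapMatrix ℝ *ᵥ g)) ≤
      (G.lapMatrix ℝ *ᵥ g) ⬝ᵥ (G.lapMatrix ℝ *ᵥ g) := by
  obtain rfl : hd = fun a b => Classical.propDecidable (a = b) := Subsingleton.elim _ _
  obtain rfl : hr = fun a b => Classical.propDecidable (G.Adj a b) := Subsingleton.elim _ _
  classical
  let hL := G.isHermitian_lapMatrix ℝ
  have hpsd : (G.lapMatrix ℝ).PosSemidef := G.posSemidef_lapMatrix ℝ
  have hzero : ∃ i, hL.eigenvalues i = 0 := by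
    have hne : Nonempty V := Fintype.card_pos_iff.mp (by omega)
    have hdet : (G.lapMatrix ℝ).det = 0 := by
      refine Matrix.exists_mulVec_eq_zero_iff.mp ⟨fun _ => 1, ?_, ?_⟩
      · intro h
        exact one_ne_zero (congrFun h hne.some)
      · exact G.lapMatrix_mulVec_const_eq_zero (R := ℝ)
    rw [hL.det_eq_prod_eigenvalues] at hdet
    obtain ⟨i, -, hi⟩ := Finset.prod_eq_zero_iff.mp hdet
    exact ⟨i, by simpa using hi⟩
  have hcoef : ∀ i, 0 ≤ (hL.eigenvalues i - algebraicConnectivity G hV) * hL.eigenvalues i := by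
    intro i
    have h0 : 0 ≤ hL.eigenvalues i := hpsd.eigenvalues_nonneg i
    obtain ⟨m, hm⟩ := hzero
    let e := Fintype.equivOfCardEq (α := Fin (Fintype.card V)) (β := V) (Fintype.card_fin _)
    have hev : ∀ i, hL.eigenvalues i = hL.eigenvalues₀ (e.symm i) := fun i => rfl
    by_cases hi : (e.symm i : ℕ) ≤ Fintype.card V - 2
    · have : algebraicConnectivity G hV ≤ hL.eigenvalues i := by
        rw [hev]
        exact hL.eigenvalues₀_antitone (Fin.mk_le_mk.mpr hi)
      exact mul_nonneg (sub_nonneg.mpr this) h0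
    -- Only the last index remains; its eigenvalue is at most the known zero one, hence zero.
    · have : hL.eigenvalues i ≤ hL.eigenvalues m := by
        rw [hev, hev]
        refine hL.eigenvalues₀_antitone (Fin.le_def.mpr ?_)
        have := (e.symm m).isLt
        omega
      rw [le_antisymm (this.trans hm.le) h0, mul_zero]
  let b := hL.eigenvectorBasis
  have hb : ∀ i, inner ℝ (b i) (WithLp.toLp 2 (G.lapMatrix ℝ *ᵥ g)) =
      hL.eigenvalues i * inner ℝ (b i) (WithLp.toLp 2 g) := by
    intro i
    have h1 := hL.mulVec_eigenvectorBasis i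
    have hT : (G.lapMatrix ℝ)ᵀ = G.lapMatrix ℝ := G.isSymm_lapMatrix (R := ℝ)
    simp only [EuclideanSpace.inner_eq_star_dotProduct, star_trivial]
    rw [dotProduct_comm, dotProduct_mulVec, ← mulVec_transpose, hT]
    erw [h1]
    rw [smul_dotProduct, dotProduct_comm, smul_eq_mul]
  have hsum : ∀ x y : V → ℝ, x ⬝ᵥ y =
      ∑ i, inner ℝ (b i) (WithLp.toLp 2 x) * inner ℝ (b i) (WithLp.toLp 2 y) := by
    intro x y
    have := b.sum_inner_mul_inner (WithLp.toLp 2 x) (WithLp.toLp 2 y)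
    rw [EuclideanSpace.inner_eq_star_dotProduct (WithLp.toLp 2 x)] at this
    simp only [star_trivial] at this
    rw [dotProduct_comm, ← this]
    exact Finset.sum_congr rfl fun i _ => by rw [real_inner_comm]
  rw [hsum, hsum, Finset.mul_sum]
  refine Finset.sum_le_sum fun i _ => ?_
  rw [hb]
  nlinarith [mul_nonneg (hcoef i) (sq_nonneg (inner ℝ (b i) (WithLp.toLp 2 g)))]

theorem lapMatrix_mulVec_eq_sum {V : Type*} [Fintype V] [DecidableEq V] (G : SimpleGraph V)
    [DecidableRel G.Adj] (g : V → ℝ) (v : V) :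
    (G.lapMatrix ℝ *ᵥ g) v = ∑ w, if G.Adj v w then g v - g w else 0 := by
  rw [SimpleGraph.lapMatrix_mulVec_apply, ← Finset.sum_filter, Finset.sum_sub_distrib,
    Finset.sum_const, nsmul_eq_mul, ← G.neighborFinset_eq_filter, G.card_neighborFinset_eq_degree]

theorem sum_sigma_fin {k : ℕ} (q : Fin k → ℕ) (f : Fin k → ℝ) :
    ∑ p : (Σ i : Fin k, Fin (q i)), f p.1 = ∑ i, q i * f i := by
  rw [Fintype.sum_sigma]
  simp

/-- The function on the vertices with value `c i` at the path vertex `i` and value `c i - d i` at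
its pendant vertices. -/
def vertexFun {k : ℕ} (q : Fin k → ℕ) (c d : Fin k → ℝ) : Vertex q → ℝ
  | .inl i => c i
  | .inr p => c p.1 - d p.1

theorem lapMatrix_mulVec_vertexFun {k : ℕ} (q : Fin k → ℕ) [DecidableRel (graph q).Adj]
    [DecidableRel (SimpleGraph.pathGraph k).Adj] (c d : Fin k → ℝ) :
    (graph q).lapMatrix ℝ *ᵥ vertexFun q c d =
      Sum.elim (fun i => ((SimpleGraph.pathGraph k).lapMatrix ℝ *ᵥ c) i + q i * d i)
        (fun p => -d p.1) := by
  ext (i | p)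
  · rw [lapMatrix_mulVec_eq_sum, Fintype.sum_sum_type, Sum.elim_inl, lapMatrix_mulVec_eq_sum]
    have : ∀ p : (Σ i : Fin k, Fin (q i)), (if (graph q).Adj (.inl i) (.inr p) then
        vertexFun q c d (.inl i) - vertexFun q c d (.inr p) else 0) =
        (fun l => if l = i then d l else 0) p.1 := by
      intro p
      by_cases h : p.1 = i
      · subst h
        simp [graph, adj, vertexFun]
      · simp [graph, adj, h]
    rw [Finset.sum_congr rfl fun p _ => this p, sum_sigma_fin q (fun l => if l = i then d l else 0)]
    simp only [mul_ite, mul_zero, Finset.sum_ite_eq', Finset.mem_univ, if_true]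
    exact congrArg (· + _) (Finset.sum_congr rfl fun l _ => if_congr Iff.rfl rfl rfl)
  · rw [lapMatrix_mulVec_eq_sum, Fintype.sum_sum_type, Fintype.sum_eq_single p.1]
    · simp [graph, adj, vertexFun]
    · intro i hi
      simp [graph, adj, hi.symm]

/-- Testing the Laplacian of the caterpillar with the functions `vertexFun q c d`. -/
theorem mu_mul_le {k : ℕ} (q : Fin k → ℕ) [DecidableRel (SimpleGraph.pathGraph k).Adj]
    (hk : 2 ≤ k) (c d r : Fin k → ℝ) (hr : (SimpleGraph.pathGraph k).lapMatrix ℝ *ᵥ c = r) :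
    mu q hk * (∑ i, c i * r i + ∑ i, q i * d i ^ 2) ≤
      ∑ i, (r i + q i * d i) ^ 2 + ∑ i, q i * d i ^ 2 := by
  classical
  have h := algebraicConnectivity_mul_dotProduct_le (graph q) (two_le_card_vertex q hk)
    (vertexFun q c d)
  rw [lapMatrix_mulVec_vertexFun, hr] at h
  simp only [dotProduct, Fintype.sum_sum_type, Sum.elim_inl, Sum.elim_inr, vertexFun] at h
  rw [sum_sigma_fin q (fun i => (c i - d i) * -d i), sum_sigma_fin q (fun i => -d i * -d i),
    ← Finset.sum_add_distrib, ← Finset.sum_add_distrib] at h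
  rw [← Finset.sum_add_distrib, ← Finset.sum_add_distrib]
  refine (congrArg (_ * ·) ?_).trans_le (h.trans_eq ?_) <;>
    exact Finset.sum_congr rfl fun i _ => by ring

/-- The Laplacian of the path applied to a step function. -/
theorem lapMatrix_pathGraph_mulVec_step {k : ℕ} [DecidableRel (SimpleGraph.pathGraph k).Adj]
    {m n : Fin k} (hmn : (n : ℕ) = m + 1) (t : ℝ) :
    (SimpleGraph.pathGraph k).lapMatrix ℝ *ᵥ (fun i => if i ≤ m then 0 else t) =
      fun i => (if i = n then t else 0) - (if i = m then t else 0) := by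
  ext i
  rw [lapMatrix_mulVec_eq_sum]
  have : ∀ l : Fin k, (if (SimpleGraph.pathGraph k).Adj i l then
      (if i ≤ m then 0 else t) - (if l ≤ m then 0 else t) else 0) =
      (if l = m then (if i = n then t else 0) else 0) -
        (if l = n then (if i = m then t else 0) else 0) := by
    intro l
    simp only [SimpleGraph.pathGraph_adj, Fin.le_def, Fin.ext_iff]
    split_ifs <;> first | omega | simp
  rw [Finset.sum_congr rfl fun l _ => this l, Finset.sum_sub_distrib]
  simp

/-- The path values form a step of height `t` across the edge `mn`, so no other path edge
contributes. -/
theorem mu_mul_edge_le {k : ℕ} (q : Fin k → ℕ) (hk : 2 ≤ k) {m n : Fin k}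
    (hmn : (n : ℕ) = m + 1) (s t u : ℝ) :
    mu q hk * (q m * s ^ 2 + t ^ 2 + q n * u ^ 2) ≤
      (q m * s + t) ^ 2 + q m * s ^ 2 + (t + q n * u) ^ 2 + q n * u ^ 2 := by
  classical
  have hne : m ≠ n := fun h => by
    rw [h] at hmn
    omega
  have hlt : ¬ n ≤ m := by
    rw [Fin.le_def]
    omega
  -- The sign of `s` makes both terms at `m` add up: `Lg` is `-(q m * s + t)` there.
  have h := mu_mul_le q hk _ (fun i => (if i = n then u else 0) - (if i = m then s else 0)) _
    (lapMatrix_pathGraph_mulVec_step hmn t)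
  have hsum : ∀ f : Fin k → ℝ, (∀ i, i ≠ m → i ≠ n → f i = 0) → ∑ i, f i = f m + f n := by
    intro f hf
    exact Fintype.sum_eq_add m n hne fun i hi => hf i hi.1 hi.2
  rw [hsum, hsum, hsum] at h
  · simp only [le_refl, if_true, hne, hne.symm, hlt, if_false] at h
    convert h using 1 <;> ring
  all_goals
    intro i him hin
    simp [him, hin]

/-- The quadratic form of `C(q_m, q_n) + 2 - μ` is nonnegative, for consecutive `m`, `n`. -/
theorem mu_mul_dotProduct_le {k : ℕ} (q : Fin k → ℕ) (hk : 2 ≤ k) {m n : Fin k}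
    (hmn : (n : ℕ) = m + 1) (x : Fin 3 → ℝ) :
    mu q hk * (x ⬝ᵥ x) ≤ x ⬝ᵥ (C (q m) (q n) *ᵥ x) + 2 * (x ⬝ᵥ x) := by
  -- Testing the edge `mn` alone; needed when `q m` or `q n` is zero.
  have h2 : mu q hk ≤ 2 := by
    have := mu_mul_edge_le q hk hmn 0 1 0
    norm_num at this
    exact this
  -- For `a ≥ 1`, `s = z / √a` and `δ = 0`. For `a = 0` there are no pendant edges to carry `z`, and
  -- the loss is `δ = z ^ 2`.
  have key : ∀ a : ℕ, ∀ z : ℝ, ∃ s δ : ℝ, 0 ≤ δ ∧ a * s = √(a : ℝ) * z ∧ a * s ^ 2 = z ^ 2 - δ ∧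
      max 0 ((a : ℝ) - 1) * z ^ 2 = (a * s) ^ 2 - z ^ 2 + δ := by
    intro a z
    rcases Nat.eq_zero_or_pos a with rfl | ha
    · exact ⟨0, z ^ 2, sq_nonneg z, by simp⟩
    · have ha' : (1 : ℝ) ≤ a := by exact_mod_cast ha
      have hs : √(a : ℝ) ^ 2 = a := Real.sq_sqrt (by linarith)
      have hs0 : √(a : ℝ) ≠ 0 := (Real.sqrt_pos.mpr (by linarith)).ne'
      have has : (a : ℝ) * (z / √(a : ℝ)) = √(a : ℝ) * z := by
        field_simp
        rw [hs, mul_comm]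
      refine ⟨z / √(a : ℝ), 0, le_rfl, has, ?_, ?_⟩
      · rw [div_pow, hs]
        field_simp
        simp
      · rw [has, mul_pow, hs, max_eq_right (by linarith)]
        ring
  obtain ⟨s, δ, hδ, hs1, hs2, hs3⟩ := key (q m) (x 0)
  obtain ⟨u, ε, hε, hu1, hu2, hu3⟩ := key (q n) (x 2)
  have h := mu_mul_edge_le q hk hmn s (x 1) u
  have hC : x ⬝ᵥ (C (q m) (q n) *ᵥ x) = max 0 ((q m : ℝ) - 1) * x 0 ^ 2 +
      2 * (√(q m : ℝ) * x 0) * x 1 + 2 * (√(q n : ℝ) * x 2) * x 1 +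
      max 0 ((q n : ℝ) - 1) * x 2 ^ 2 := by
    simp [dotProduct, mulVec, C, Fin.sum_univ_three]
    ring
  have hx : x ⬝ᵥ x = x 0 ^ 2 + x 1 ^ 2 + x 2 ^ 2 := by
    simp [dotProduct, Fin.sum_univ_three]
    ring
  rw [hC, hx, hs3, hu3, ← hs1, ← hu1]
  rw [hs2, hu2] at h
  -- The gap left by the losses is `(2 - μ) * (δ + ε)`.
  nlinarith [mul_nonneg hδ (sub_nonneg.mpr h2), mul_nonneg hε (sub_nonneg.mpr h2)]

theorem mu_le_lambda3_add_two {k : ℕ} (q : Fin k → ℕ) (hk : 2 ≤ k) {m n : Fin k}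
    (hmn : (n : ℕ) = m + 1) : mu q hk ≤ lambda3 (q m) (q n) + 2 := by
  have hC := isHermitian_C (q m) (q n)
  let e := Fintype.equivOfCardEq (α := Fin (Fintype.card (Fin 3))) (β := Fin 3) (Fintype.card_fin _)
  let i : Fin 3 := e ⟨2, by simp⟩
  have hi : hC.eigenvalues i = lambda3 (q m) (q n) := by
    change hC.eigenvalues₀ (e.symm (e _)) = _
    rw [Equiv.symm_apply_apply]
    rfl
  let x : EuclideanSpace ℝ (Fin 3) := hC.eigenvectorBasis i
  have hx : x.ofLp ⬝ᵥ x.ofLp = 1 := by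
    have h1 : inner ℝ x x = (1 : ℝ) := by
      rw [real_inner_self_eq_norm_sq, hC.eigenvectorBasis.norm_eq_one, one_pow]
    simpa only [EuclideanSpace.inner_eq_star_dotProduct, star_trivial] using h1
  have h := mu_mul_dotProduct_le q hk hmn x.ofLp
  have hev : C (q m) (q n) *ᵥ x.ofLp = lambda3 (q m) (q n) • x.ofLp := by
    rw [← hi]
    exact hC.mulVec_eigenvectorBasis i
  rw [hev, dotProduct_smul, hx] at h
  simpa using h

end Caterpillar

theorem mainTheorem6 (k : ℕ) (hk : 4 ≤ k) (q : Fin k → ℕ)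
    (hq_first : q ⟨0, by omega⟩ ≠ 0) (hq_last : q ⟨k - 1, by omega⟩ ≠ 0) :
    Caterpillar.mu q (by omega) ≤
      (Finset.univ : Finset (Fin (k - 1))).inf' ⟨⟨0, by omega⟩, Finset.mem_univ _⟩
        (fun j => Caterpillar.lambda3 (q ⟨j, by omega⟩) (q ⟨j + 1, by omega⟩)) + 2 := by

  rw [← sub_le_iff_le_add]
  refine Finset.le_inf' _ _ fun j _ => ?_
  rw [sub_le_iff_le_add]
  exact Caterpillar.mu_le_lambda3_add_two q (by omega) rfl
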